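/- Let $1\le m<n$, let $A\in\mathbb{R}^{m\times n}$ have full row rank $m$, let $b\in\mathbb{R}^m$, $c\in\mathbb{R}^n$, and suppose that the polyhedron $\{x\in\mathbb{R}^n: Ax=b,\ x\ge 0\}$ is bounded. Consider the linear program $\min\{c^Tx : Ax=b,\ x\ge 0\}$. A basis is a choice of $m$ columns of $A$ forming an invertible matrix $B$; its basic solution has $x_B=B^{-1}b$ and $x_N=0$, and it is a basic feasible solution (BFS) if $B^{-1}b\ge 0$. Suppose that some BFS has a positive coordinate, and let $\gamma$ and $\delta$ be the maximum and the minimum of the positive coordinates of all BFS. Let $\Delta$ and $\lambda$ be the maximum and the minimum of the absolute values of the nonzero determinants of $m\times m$ submatrices of $A$. Suppose that $m\ge 2$ or $\gamma\neq\delta$. The steepest-edge simplex method starts at any feasible basis. At a feasible basis $B$, for each nonbasic index $q$ let $\eta^q$ be the edge direction whose basic part is $-B^{-1}A_q$ and whose nonbasic part is the unit vector $e_q$, and let $\bar c^q=c^T\eta^q$ be the reduced cost. If all reduced costs are nonnegative the method stops; otherwise the entering index is a nonbasic index $q$ that minimizes $\bar c^q/\|\eta^q\|_2$, and the leaving index is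 determined by the minimum ratio test. Ties are broken arbitrarily, and degenerate pivots are allowed. Then every run of the steepest-edge simplex method generates at most $$n\left\lceil m\sqrt{2m}\,\frac{\gamma^2\Delta}{\delta^2\lambda}\,\log\!\left(m\frac{\gamma}{\delta}\right)\right\rceil$$ different BFS, the initial one included. -/

import Mathlib

open Matrix

namespace SteepestEdge

noncomputable section

/-- The feasible region `{x : A x = b, x ≥ 0}` of the linear program
`min cᵀx` subject to `A x = b`, `x ≥ 0`. -/
def feasibleSet {m n : ℕ} (A : Matrix (Fin m) (Fin n) ℝ) (b : Fin m → ℝ) : Set (Fin n → ℝ) :=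
  {x | A *ᵥ x = b ∧ ∀ j, 0 ≤ x j}

/-- The square matrix formed by the columns of `A` listed by `β`. -/
def basisMatrix {m n : ℕ} (A : Matrix (Fin m) (Fin n) ℝ) (β : Fin m → Fin n) :
    Matrix (Fin m) (Fin m) ℝ :=
  A.submatrix id β

/-- The list `β` of column indices is a feasible basis: the chosen columns of `A` form an
invertible matrix `B` (so that `β` has no repetitions), and `B⁻¹ b ≥ 0`. -/
def IsFeasibleBasis {m n : ℕ} (A : Matrix (Fin m) (Fin n) ℝ) (b : Fin m → ℝ)
    (β : Fin m → Fin n) : Prop :=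
  (basisMatrix A β).det ≠ 0 ∧ ∀ i, 0 ≤ ((basisMatrix A β)⁻¹ *ᵥ b) i

/-- The vector of `ℝⁿ` whose coordinate at `β i` is `v i`, and whose coordinates outside the
range of `β` vanish (`β` is meant to be injective). -/
def extendByZero {m n : ℕ} (β : Fin m → Fin n) (v : Fin m → ℝ) : Fin n → ℝ :=
  fun j => ∑ i, if β i = j then v i else 0

/-- The basic solution `x_B = B⁻¹ b`, `x_N = 0` of the basis `β`. -/
def basicSolution {m n : ℕ} (A : Matrix (Fin m) (Fin n) ℝ) (b : Fin m → ℝ)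
    (β : Fin m → Fin n) : Fin n → ℝ :=
  extendByZero β ((basisMatrix A β)⁻¹ *ᵥ b)

/-- `x` is a basic feasible solution (BFS). -/
def IsBFS {m n : ℕ} (A : Matrix (Fin m) (Fin n) ℝ) (b : Fin m → ℝ) (x : Fin n → ℝ) : Prop :=
  ∃ β : Fin m → Fin n, IsFeasibleBasis A b β ∧ x = basicSolution A b β

/-- The positive real numbers that occur as a coordinate of some BFS. -/
def positiveCoordinates {m n : ℕ} (A : Matrix (Fin m) (Fin n) ℝ) (b : Fin m → ℝ) : Set ℝ :=
  {r | 0 < r ∧ ∃ x, IsBFS A b x ∧ ∃ j, x j = r}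

/-- The absolute values of the nonzero determinants of the `m × m` submatrices of `A`. -/
def absSubdeterminants {m n : ℕ} (A : Matrix (Fin m) (Fin n) ℝ) : Set ℝ :=
  {r | r ≠ 0 ∧ ∃ f : Fin m ↪ Fin n, |(A.submatrix id f).det| = r}

/-- The transformed column `B⁻¹ A_q`. -/
def tableauColumn {m n : ℕ} (A : Matrix (Fin m) (Fin n) ℝ) (β : Fin m → Fin n) (q : Fin n) :
    Fin m → ℝ :=
  (basisMatrix A β)⁻¹ *ᵥ (fun i => A i q)

/-- The edge direction `η^q` of the nonbasic index `q`: it is `-B⁻¹ A_q` on the basic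
coordinates and the unit vector `e_q` on the nonbasic ones. -/
def edgeDirection {m n : ℕ} (A : Matrix (Fin m) (Fin n) ℝ) (β : Fin m → Fin n) (q : Fin n) :
    Fin n → ℝ :=
  Pi.single q 1 - extendByZero β (tableauColumn A β q)

/-- The reduced cost `cᵀ η^q`. -/
def reducedCost {m n : ℕ} (A : Matrix (Fin m) (Fin n) ℝ) (c : Fin n → ℝ) (β : Fin m → Fin n)
    (q : Fin n) : ℝ :=
  c ⬝ᵥ edgeDirection A β q

/-- The reduced cost divided by the Euclidean norm of the edge direction. -/
def normalizedReducedCost {m n : ℕ} (A : Matrix (Fin m) (Fin n) ℝ) (c : Fin n → ℝ)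
    (β : Fin m → Fin n) (q : Fin n) : ℝ :=
  reducedCost A c β q / ‖(WithLp.toLp 2 (edgeDirection A β q) : EuclideanSpace ℝ (Fin n))‖

/-- `q` may enter the basis by the steepest-edge rule: it is nonbasic, its reduced cost is
negative, and it minimizes the normalized reduced cost over all nonbasic indices. -/
def IsSteepestEdgeEntering {m n : ℕ} (A : Matrix (Fin m) (Fin n) ℝ) (c : Fin n → ℝ)
    (β : Fin m → Fin n) (q : Fin n) : Prop :=
  q ∉ Set.range β ∧ reducedCost A c β q < 0 ∧
    ∀ q', q' ∉ Set.range β → normalizedReducedCost A c β q ≤ normalizedReducedCost A c β q'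

/-- The position `p` may leave the basis by the minimum ratio test when `q` enters. -/
def IsLeaving {m n : ℕ} (A : Matrix (Fin m) (Fin n) ℝ) (b : Fin m → ℝ) (β : Fin m → Fin n)
    (q : Fin n) (p : Fin m) : Prop :=
  0 < tableauColumn A β q p ∧
    ∀ i, 0 < tableauColumn A β q i →
      ((basisMatrix A β)⁻¹ *ᵥ b) p / tableauColumn A β q p ≤
        ((basisMatrix A β)⁻¹ *ᵥ b) i / tableauColumn A β q i

/-- `β'` arises from `β` by one (possibly degenerate) steepest-edge pivot of the simplex method;
ties, in the entering and in the leaving index, may be broken in any way. -/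
def IsSteepestEdgePivot {m n : ℕ} (A : Matrix (Fin m) (Fin n) ℝ) (b : Fin m → ℝ)
    (c : Fin n → ℝ) (β β' : Fin m → Fin n) : Prop :=
  ∃ q p, IsSteepestEdgeEntering A c β q ∧ IsLeaving A b β q p ∧ β' = Function.update β p q

/-- `β 0, β 1, …, β T` (an infinite sequence if `T = ⊤`) are the successive bases in a run of the
steepest-edge simplex method, started at an arbitrary feasible basis. -/
def IsSteepestEdgeRun {m n : ℕ} (A : Matrix (Fin m) (Fin n) ℝ) (b : Fin m → ℝ)
    (c : Fin n → ℝ) (T : ℕ∞) (β : ℕ → Fin m → Fin n) : Prop :=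
  IsFeasibleBasis A b (β 0) ∧
    ∀ t : ℕ, (t : ℕ∞) < T → IsSteepestEdgePivot A b c (β t) (β (t + 1))

/-- The set of the (distinct) basic solutions generated in a run, the initial one included. -/
def generatedBFS {m n : ℕ} (A : Matrix (Fin m) (Fin n) ℝ) (b : Fin m → ℝ) (T : ℕ∞)
    (β : ℕ → Fin m → Fin n) : Set (Fin n → ℝ) :=
  {x | ∃ t : ℕ, (t : ℕ∞) ≤ T ∧ x = basicSolution A b (β t)}

end

end SteepestEdge

/-! The gap to the optimal value contracts geometrically, and each sufficiently long contraction
permanently annihilates a coordinate.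

By Cramer's rule every edge direction has norm between `1` and `√(2m) Δ/λ`. The gap of a basis to a
BFS `y` is a combination of the negated reduced costs with weights `y q`, of total at most `mγ`.
Hence it is at most `mγ √(2m) Δ/λ` times the steepest slope (`IsSteepestEdgeEntering.gap_le`). If a
pivot changes the BFS, the entering variable becomes a positive coordinate, so the step length is at
least `δ` and the cost falls by at least `δ` times that slope. With `M` the factor in front of the
logarithm, each change therefore multiplies the gap by at most `1 - 1/M`
(`IsSteepestEdgePivot.gap_le`).

Near-optimal dual slacks show that a nonoptimal BFS has a positive coordinate which is below `δ`,
hence zero, at every BFS whose gap is smaller by a factor less than `δ/(mγ)`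
(`IsBFS.exists_forced_coordinate`). A block of `K = ⌈M log(mγ/δ)⌉` changes achieves this factor.
More than `nK` distinct BFS would give `n` blocks annihilating `n` distinct coordinates, hence a BFS
equal to zero. This forces `b = 0`, although some BFS has a positive coordinate. -/

namespace SteepestEdge

/-! ### Basic solutions and edge directions -/

section Basis

variable {m n : ℕ} {A : Matrix (Fin m) (Fin n) ℝ} {b : Fin m → ℝ} {c : Fin n → ℝ}
  {β : Fin m → Fin n}

theorem injective_of_det_ne_zero (h : (basisMatrix A β).det ≠ 0) : Function.Injective β := by
  intro i j hij
  by_contra hne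
  exact h (Matrix.det_zero_of_column_eq hne fun k => by simp [basisMatrix, hij])

theorem extendByZero_apply (hβ : Function.Injective β) (v : Fin m → ℝ) (i : Fin m) :
    extendByZero β v (β i) = v i := by
  simp [extendByZero, hβ.eq_iff]

theorem extendByZero_apply_of_notMem (v : Fin m → ℝ) {j : Fin n} (hj : j ∉ Set.range β) :
    extendByZero β v j = 0 :=
  Finset.sum_eq_zero fun i _ => if_neg fun h => hj ⟨i, h⟩

theorem sum_mul_extendByZero (s : Fin n → ℝ) (v : Fin m → ℝ) :
    ∑ j, s j * extendByZero β v j = ∑ i, s (β i) * v i := by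
  simp only [extendByZero, Finset.mul_sum]
  rw [Finset.sum_comm]
  simp

theorem mulVec_extendByZero (v : Fin m → ℝ) :
    A *ᵥ extendByZero β v = basisMatrix A β *ᵥ v := by
  funext k
  simp only [mulVec, dotProduct, basisMatrix, submatrix_apply, id]
  exact sum_mul_extendByZero (A k) v

theorem eq_extendByZero (hβ : Function.Injective β) {d : Fin n → ℝ}
    (hd : ∀ j, j ∉ Set.range β → d j = 0) : d = extendByZero β (d ∘ β) := by
  funext j
  by_cases hj : j ∈ Set.range β
  · obtain ⟨i, rfl⟩ := hj
    rw [extendByZero_apply hβ]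
    rfl
  · rw [hd j hj, extendByZero_apply_of_notMem _ hj]

theorem basisMatrix_mulVec_comp (hβ : Function.Injective β) {d : Fin n → ℝ}
    (hd : ∀ j, j ∉ Set.range β → d j = 0) : basisMatrix A β *ᵥ (d ∘ β) = A *ᵥ d := by
  rw [← mulVec_extendByZero, ← eq_extendByZero hβ hd]

theorem inv_mulVec_eq_comp (h : (basisMatrix A β).det ≠ 0) {d : Fin n → ℝ}
    (hd : ∀ j, j ∉ Set.range β → d j = 0) : (basisMatrix A β)⁻¹ *ᵥ (A *ᵥ d) = d ∘ β := by
  rw [← basisMatrix_mulVec_comp (injective_of_det_ne_zero h) hd, mulVec_mulVec,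
    nonsing_inv_mul _ (isUnit_iff_ne_zero.2 h), one_mulVec]

theorem eq_basicSolution (h : (basisMatrix A β).det ≠ 0) {d : Fin n → ℝ}
    (hd : ∀ j, j ∉ Set.range β → d j = 0) (hAd : A *ᵥ d = b) : d = basicSolution A b β := by
  rw [basicSolution, ← hAd, inv_mulVec_eq_comp h hd]
  exact eq_extendByZero (injective_of_det_ne_zero h) hd

theorem isFeasibleBasis_of_supported (h : (basisMatrix A β).det ≠ 0) {d : Fin n → ℝ}
    (hd : ∀ j, j ∉ Set.range β → d j = 0) (hf : d ∈ feasibleSet A b) : IsFeasibleBasis A b β := by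
  refine ⟨h, fun i => ?_⟩
  rw [← hf.1, inv_mulVec_eq_comp h hd]
  exact hf.2 _

theorem eq_zero_of_mulVec_eq_zero (h : (basisMatrix A β).det ≠ 0) {d : Fin n → ℝ}
    (hd : ∀ j, j ∉ Set.range β → d j = 0) (hAd : A *ᵥ d = 0) : d = 0 := by
  have h1 := eq_basicSolution h hd hAd
  rw [h1, basicSolution, mulVec_zero]
  funext j
  simp [extendByZero]

theorem basicSolution_apply (h : (basisMatrix A β).det ≠ 0) (i : Fin m) :
    basicSolution A b β (β i) = ((basisMatrix A β)⁻¹ *ᵥ b) i :=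
  extendByZero_apply (injective_of_det_ne_zero h) _ i

theorem basicSolution_apply_of_notMem {j : Fin n} (hj : j ∉ Set.range β) :
    basicSolution A b β j = 0 :=
  extendByZero_apply_of_notMem _ hj

theorem mulVec_basicSolution (h : (basisMatrix A β).det ≠ 0) : A *ᵥ basicSolution A b β = b := by
  rw [basicSolution, mulVec_extendByZero, mulVec_mulVec,
    mul_nonsing_inv _ (isUnit_iff_ne_zero.2 h), one_mulVec]

theorem IsFeasibleBasis.basicSolution_mem (h : IsFeasibleBasis A b β) :
    basicSolution A b β ∈ feasibleSet A b := by
  refine ⟨mulVec_basicSolution h.1, fun j => ?_⟩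
  by_cases hj : j ∈ Set.range β
  · obtain ⟨i, rfl⟩ := hj
    exact basicSolution_apply (b := b) h.1 i ▸ h.2 i
  · exact (basicSolution_apply_of_notMem hj).ge

theorem IsFeasibleBasis.isBFS (h : IsFeasibleBasis A b β) : IsBFS A b (basicSolution A b β) :=
  ⟨β, h, rfl⟩

theorem IsBFS.mem_feasibleSet {x : Fin n → ℝ} (h : IsBFS A b x) : x ∈ feasibleSet A b := by
  obtain ⟨β, hβ, rfl⟩ := h
  exact hβ.basicSolution_mem

theorem IsBFS.le_of_isGreatest {γ : ℝ} (hγ : IsGreatest (positiveCoordinates A b) γ)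
    {x : Fin n → ℝ} (h : IsBFS A b x) (j : Fin n) : x j ≤ γ := by
  by_cases hx : 0 < x j
  · exact hγ.2 ⟨hx, x, h, j, rfl⟩
  · exact (not_lt.1 hx).trans hγ.1.1.le

theorem IsBFS.eq_zero_of_lt {δ : ℝ} (hδ : IsLeast (positiveCoordinates A b) δ)
    {x : Fin n → ℝ} (h : IsBFS A b x) {j : Fin n} (hj : x j < δ) : x j = 0 := by
  by_contra h0
  exact hj.not_ge (hδ.2 ⟨lt_of_le_of_ne (h.mem_feasibleSet.2 j) (Ne.symm h0), x, h, j, rfl⟩)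

theorem IsBFS.sum_le {γ : ℝ} (hγ : IsGreatest (positiveCoordinates A b) γ)
    {x : Fin n → ℝ} (h : IsBFS A b x) : ∑ j, x j ≤ m * γ := by
  have hle := h.le_of_isGreatest hγ
  obtain ⟨β, hβ, rfl⟩ := h
  have h1 := sum_mul_extendByZero (β := β) (fun _ => 1) ((basisMatrix A β)⁻¹ *ᵥ b)
  simp only [one_mul] at h1
  rw [basicSolution, h1]
  calc ∑ i, ((basisMatrix A β)⁻¹ *ᵥ b) i ≤ ∑ _i : Fin m, γ :=
        Finset.sum_le_sum fun i _ => basicSolution_apply (b := b) hβ.1 i ▸ hle (β i)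
    _ = m * γ := by simp

/-! ### Edge directions -/

theorem edgeDirection_apply_of_notMem (q : Fin n) {j : Fin n} (hj : j ∉ Set.range β) :
    edgeDirection A β q j = (Pi.single q 1 : Fin n → ℝ) j := by
  simp [edgeDirection, extendByZero_apply_of_notMem _ hj]

theorem edgeDirection_apply_basic (h : (basisMatrix A β).det ≠ 0) {q : Fin n}
    (hq : q ∉ Set.range β) (i : Fin m) :
    edgeDirection A β q (β i) = - tableauColumn A β q i := by
  have : β i ≠ q := fun h' => hq ⟨i, h'⟩
  simp [edgeDirection, extendByZero_apply (injective_of_det_ne_zero h), this]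

theorem mulVec_edgeDirection (h : (basisMatrix A β).det ≠ 0) (q : Fin n) :
    A *ᵥ edgeDirection A β q = 0 := by
  rw [edgeDirection, mulVec_sub, mulVec_extendByZero, tableauColumn, mulVec_mulVec,
    mul_nonsing_inv _ (isUnit_iff_ne_zero.2 h), one_mulVec, mulVec_single_one, sub_eq_zero]
  rfl

-- Both sides have the same nonbasic coordinates and the same image under `A`, and the basis columns
-- are independent.
open Classical in
theorem sub_basicSolution_eq_sum (h : (basisMatrix A β).det ≠ 0) {x : Fin n → ℝ}
    (hx : A *ᵥ x = b) :
    x - basicSolution A b β =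
      ∑ q with q ∉ Set.range β, x q • edgeDirection A β q := by
  rw [← sub_eq_zero]
  refine eq_zero_of_mulVec_eq_zero h (fun j hj => ?_) ?_
  · simp only [Pi.sub_apply, basicSolution_apply_of_notMem hj, Finset.sum_apply, Pi.smul_apply,
      edgeDirection_apply_of_notMem _ hj, Pi.single_apply, smul_eq_mul, mul_ite, mul_one, mul_zero,
      Finset.sum_ite_eq, Finset.mem_filter_univ, if_pos hj]
    ring
  · rw [mulVec_sub, mulVec_sub, hx, mulVec_basicSolution h, sub_self, mulVec_sum]
    simp [mulVec_smul, mulVec_edgeDirection h]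

open Classical in
theorem dotProduct_sub_eq_sum (h : (basisMatrix A β).det ≠ 0) {x : Fin n → ℝ}
    (hx : A *ᵥ x = b) :
    c ⬝ᵥ x - c ⬝ᵥ basicSolution A b β =
      ∑ q with q ∉ Set.range β, x q * reducedCost A c β q := by
  rw [← dotProduct_sub, sub_basicSolution_eq_sum h hx, dotProduct_sum]
  simp [reducedCost]

/-- Cramer's rule: a tableau entry is the ratio of two `m × m` minors, which is how `Δ / lam` comes
to bound it. -/
theorem det_update_basisMatrix (h : (basisMatrix A β).det ≠ 0) (q : Fin n) (p : Fin m) :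
    (basisMatrix A (Function.update β p q)).det =
      tableauColumn A β q p * (basisMatrix A β).det := by
  have h1 : basisMatrix A (Function.update β p q) =
      (basisMatrix A β).updateCol p (fun i => A i q) := by
    ext i j
    by_cases hj : j = p <;> simp [basisMatrix, hj]
  have h2 : (fun i => A i q) = basisMatrix A β *ᵥ tableauColumn A β q := by
    rw [tableauColumn, mulVec_mulVec, mul_nonsing_inv _ (isUnit_iff_ne_zero.2 h), one_mulVec]
  rw [h1, ← cramer_apply, h2, cramer_eq_adjugate_mulVec, mulVec_mulVec, adjugate_mul,
    smul_mulVec, one_mulVec, Pi.smul_apply, smul_eq_mul, mul_comm]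

theorem abs_tableauColumn_le {Δ lam : ℝ} (hΔ : IsGreatest (absSubdeterminants A) Δ)
    (hlam : IsLeast (absSubdeterminants A) lam) (h : (basisMatrix A β).det ≠ 0) (q : Fin n)
    (p : Fin m) : |tableauColumn A β q p| ≤ Δ / lam := by
  have hpos : ∀ r ∈ absSubdeterminants A, 0 < r := by
    rintro r ⟨h0, f, rfl⟩
    exact lt_of_le_of_ne (abs_nonneg _) (Ne.symm h0)
  have hl := hpos _ hlam.1
  have hD := hpos _ hΔ.1
  have hmem : ∀ f : Fin m → Fin n, (basisMatrix A f).det ≠ 0 →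
      |(basisMatrix A f).det| ∈ absSubdeterminants A := fun f hf =>
    ⟨abs_ne_zero.2 hf, ⟨f, injective_of_det_ne_zero hf⟩, rfl⟩
  have h1 := det_update_basisMatrix h q p
  by_cases h0 : tableauColumn A β q p = 0
  · rw [h0, abs_zero]
    positivity
  · have h2 := hΔ.2 (hmem _ (h1 ▸ mul_ne_zero h0 h))
    rw [h1, abs_mul] at h2
    rw [le_div_iff₀ hl]
    exact (mul_le_mul_of_nonneg_left (hlam.2 (hmem _ h)) (abs_nonneg _)).trans h2

theorem norm_edgeDirection_sq (h : (basisMatrix A β).det ≠ 0) {q : Fin n}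
    (hq : q ∉ Set.range β) :
    ‖(WithLp.toLp 2 (edgeDirection A β q) : EuclideanSpace ℝ (Fin n))‖ ^ 2 =
      1 + ∑ i, tableauColumn A β q i ^ 2 := by
  classical
  have hβ := injective_of_det_ne_zero h
  rw [EuclideanSpace.norm_sq_eq]
  simp only [Real.norm_eq_abs, sq_abs]
  have hq' : q ∈ (Finset.univ.image β)ᶜ := by simpa using hq
  rw [← Finset.sum_compl_add_sum (Finset.univ.image β), Finset.sum_image hβ.injOn,
    Finset.sum_eq_single_of_mem q hq']
  · rw [edgeDirection_apply_of_notMem q hq]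
    simp [edgeDirection_apply_basic h hq]
  · intro j hj hjq
    rw [edgeDirection_apply_of_notMem q (by simpa using hj)]
    simp [hjq]

theorem one_le_norm_edgeDirection (h : (basisMatrix A β).det ≠ 0) {q : Fin n}
    (hq : q ∉ Set.range β) :
    1 ≤ ‖(WithLp.toLp 2 (edgeDirection A β q) : EuclideanSpace ℝ (Fin n))‖ := by
  have h1 := norm_edgeDirection_sq h hq
  have h2 : 0 ≤ ∑ i, tableauColumn A β q i ^ 2 := Finset.sum_nonneg fun i _ => sq_nonneg _
  exact (one_le_sq_iff₀ (norm_nonneg _)).1 (by linarith)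

theorem norm_edgeDirection_le {Δ lam : ℝ} (hΔ : IsGreatest (absSubdeterminants A) Δ)
    (hlam : IsLeast (absSubdeterminants A) lam) (hm : 1 ≤ m) (h : (basisMatrix A β).det ≠ 0)
    {q : Fin n} (hq : q ∉ Set.range β) :
    ‖(WithLp.toLp 2 (edgeDirection A β q) : EuclideanSpace ℝ (Fin n))‖ ≤
      √(2 * (m : ℝ)) * (Δ / lam) := by
  have hl : 0 < lam := by
    obtain ⟨h0, f, hf⟩ := hlam.1
    exact lt_of_le_of_ne (hf ▸ abs_nonneg _) (Ne.symm h0)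
  have h1 : 1 ≤ Δ / lam := (one_le_div hl).2 (hlam.2 hΔ.1)
  have hm' : (1 : ℝ) ≤ m := by exact_mod_cast hm
  refine (sq_le_sq₀ (norm_nonneg _) (by positivity)).1 ?_
  rw [norm_edgeDirection_sq h hq, mul_pow, Real.sq_sqrt (by positivity)]
  have h2 : ∑ i, tableauColumn A β q i ^ 2 ≤ ∑ _i : Fin m, (Δ / lam) ^ 2 :=
    Finset.sum_le_sum fun i _ =>
      sq_le_sq' (by linarith [(abs_le.1 (abs_tableauColumn_le hΔ hlam h q i)).1])
        (abs_le.1 (abs_tableauColumn_le hΔ hlam h q i)).2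
  rw [Finset.sum_const, Finset.card_univ, Fintype.card_fin, nsmul_eq_mul] at h2
  have h3 : 1 ≤ (Δ / lam) ^ 2 := one_le_pow₀ h1
  -- With `t = Δ / lam ≥ 1` and `m ≥ 1`, `1 + m t² ≤ 2 m t²`.
  nlinarith

end Basis

end SteepestEdge

namespace SteepestEdge

/-! ### Optimal vertices and approximate duality -/

section Optimum

variable {m n : ℕ} {A : Matrix (Fin m) (Fin n) ℝ} {b : Fin m → ℝ} {c : Fin n → ℝ}

theorem isClosed_feasibleSet : IsClosed (feasibleSet A b) := by
  have h : feasibleSet A b = {x | A *ᵥ x = b} ∩ ⋂ j, {x | 0 ≤ x j} := by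
    ext x
    simp [feasibleSet]
  rw [h]
  refine (isClosed_eq (by fun_prop) continuous_const).inter (isClosed_iInter fun j => ?_)
  exact isClosed_le continuous_const (continuous_apply j)

theorem isCompact_feasibleSet (hbdd : Bornology.IsBounded (feasibleSet A b)) :
    IsCompact (feasibleSet A b) :=
  Metric.isCompact_of_isClosed_isBounded isClosed_feasibleSet hbdd

/-- A nonzero `d` would be a recession direction, along which the feasible set contains an unbounded
ray. -/
theorem eq_zero_of_nonneg_of_mulVec_eq_zero (hbdd : Bornology.IsBounded (feasibleSet A b))
    (hne : (feasibleSet A b).Nonempty) {d : Fin n → ℝ} (hd : ∀ j, 0 ≤ d j) (hAd : A *ᵥ d = 0) :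
    d = 0 := by
  obtain ⟨x, hx⟩ := hne
  obtain ⟨R, hR⟩ := hbdd.exists_norm_le
  funext j
  by_contra h0
  have hj : 0 < d j := lt_of_le_of_ne (hd j) (Ne.symm h0)
  have hRx : 0 ≤ R := (norm_nonneg _).trans (hR x hx)
  have ht : 0 ≤ (R + 1) / d j := by positivity
  have hmem : x + ((R + 1) / d j) • d ∈ feasibleSet A b := by
    refine ⟨by rw [mulVec_add, mulVec_smul, hAd, hx.1]; simp, fun k => ?_⟩
    exact add_nonneg (hx.2 k) (mul_nonneg ht (hd k))
  have h1 := (norm_le_pi_norm _ j).trans (hR _ hmem)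
  rw [Pi.add_apply, Pi.smul_apply, smul_eq_mul, div_mul_cancel₀ _ h0, Real.norm_eq_abs] at h1
  have h2 := (abs_le.1 h1).2
  linarith [hx.2 j]

/-- A feasible point whose supporting columns are linearly independent is a basic feasible
solution. -/
theorem isBFS_of_linearIndepOn (hA : A.rank = m) {x : Fin n → ℝ} (hx : x ∈ feasibleSet A b)
    (hli : LinearIndepOn ℝ A.col {j | x j ≠ 0}) : IsBFS A b x := by
  classical
  -- The support is enlarged to a maximal independent set of columns; by the rank hypothesis it has
  -- exactly `m` elements.
  obtain ⟨s, -, hs, hspan, hsli⟩ := exists_linearIndepOn_extension hli (Set.subset_univ _)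
  have hsp : Submodule.span ℝ (A.col '' s) = Submodule.span ℝ (Set.range A.col) := by
    refine le_antisymm (Submodule.span_mono (Set.image_subset_range _ _)) ?_
    rw [Submodule.span_le, ← Set.image_univ]
    exact hspan
  have hcard : Fintype.card s = m := by
    have h1 := finrank_span_eq_card hsli
    rw [← hA, rank_eq_finrank_span_cols, ← hsp, ← h1, Set.image_eq_range]
  let e : Fin m ≃ s := (Fintype.equivFinOfCardEq hcard).symm
  have hcol : (basisMatrix A fun i => (e i : Fin n)).col =
      (fun j : s => A.col j) ∘ e := rfl
  have hdet : (basisMatrix A fun i => (e i : Fin n)).det ≠ 0 := by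
    rw [← isUnit_iff_ne_zero, ← isUnit_iff_isUnit_det, ← linearIndependent_cols_iff_isUnit, hcol]
    exact LinearIndependent.comp hsli e e.injective
  have hsupp : ∀ j, j ∉ Set.range (fun i => (e i : Fin n)) → x j = 0 := by
    intro j hj
    by_contra h0
    exact hj ⟨e.symm ⟨j, hs h0⟩, by simp⟩
  exact ⟨_, isFeasibleBasis_of_supported hdet hsupp hx, eq_basicSolution hdet hsupp hx.1⟩

/-- An extreme point of the compact optimal face works: a linear dependence `l` among its supporting
columns would allow moving both ways along `l` inside the face. -/
theorem exists_isBFS_isMinOn (hA : A.rank = m) (hbdd : Bornology.IsBounded (feasibleSet A b))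
    (hne : (feasibleSet A b).Nonempty) :
    ∃ x, IsBFS A b x ∧ ∀ y ∈ feasibleSet A b, c ⬝ᵥ x ≤ c ⬝ᵥ y := by
  have hcont : Continuous fun x : Fin n → ℝ => c ⬝ᵥ x := by fun_prop
  obtain ⟨x₀, hx₀, hmin⟩ := (isCompact_feasibleSet hbdd).exists_isMinOn hne hcont.continuousOn
  have hcomp : IsCompact (feasibleSet A b ∩ {x | c ⬝ᵥ x = c ⬝ᵥ x₀}) :=
    (isCompact_feasibleSet hbdd).inter_right (isClosed_eq hcont continuous_const)
  obtain ⟨x, ⟨hxf, hxc⟩, hext⟩ := hcomp.extremePoints_nonempty ⟨x₀, hx₀, rfl⟩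
  have hxc' : c ⬝ᵥ x = c ⬝ᵥ x₀ := hxc
  refine ⟨x, isBFS_of_linearIndepOn hA hxf ?_, fun y hy => hxc' ▸ hmin hy⟩
  rw [linearIndepOn_iff]
  intro l hl hl0
  by_contra hne0
  have hAl : A *ᵥ l = 0 := by
    rw [← hl0, Finsupp.linearCombination_apply, Finsupp.sum_fintype _ _ (by simp)]
    funext i
    simp [mulVec, dotProduct, Matrix.col, mul_comm]
  have hsupp : ∀ j, x j = 0 → l j = 0 := by
    intro j hj
    by_contra h
    exact (Finsupp.mem_supported ℝ l).1 hl (Finsupp.mem_support_iff.2 h) hj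
  obtain ⟨ε, hε, hle⟩ : ∃ ε > 0, ∀ j, ε * |l j| ≤ x j := by
    have hev : ∀ᶠ ε in nhdsWithin (0 : ℝ) (Set.Ioi 0), ∀ j, ε * |l j| ≤ x j := by
      refine Filter.eventually_all.2 fun j => ?_
      by_cases hj : x j = 0
      · simp [hsupp j hj, hj]
      · have hpos : 0 < x j := lt_of_le_of_ne (hxf.2 j) (Ne.symm hj)
        have ht : Filter.Tendsto (fun ε : ℝ => ε * |l j|) (nhds 0) (nhds (0 * |l j|)) :=
          (continuous_id.mul continuous_const).tendsto 0
        rw [zero_mul] at ht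
        exact ((ht.mono_left nhdsWithin_le_nhds).eventually_lt_const hpos).mono fun _ h => h.le
    obtain ⟨ε, h1, h2⟩ := (hev.and self_mem_nhdsWithin).exists
    exact ⟨ε, h2, h1⟩
  have hfeas : ∀ σ : ℝ, |σ| = ε → x + σ • ⇑l ∈ feasibleSet A b := by
    intro σ hσ
    refine ⟨by rw [mulVec_add, mulVec_smul, hAl, hxf.1]; simp, fun j => ?_⟩
    have h1 := hle j
    rw [← hσ, ← abs_mul] at h1
    have h2 := neg_abs_le (σ * l j)
    simp only [Pi.add_apply, Pi.smul_apply, smul_eq_mul]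
    linarith
  have hp := hfeas ε (abs_of_pos hε)
  have hn := hfeas (-ε) (by rw [abs_neg, abs_of_pos hε])
  have hp1 : c ⬝ᵥ x₀ ≤ c ⬝ᵥ (x + ε • ⇑l) := hmin hp
  have hn1 : c ⬝ᵥ x₀ ≤ c ⬝ᵥ (x + (-ε) • ⇑l) := hmin hn
  simp only [dotProduct_add, dotProduct_smul, smul_eq_mul, hxc'] at hp1 hn1
  -- Neither direction can improve on the optimum, so the cost is constant along `l` and both
  -- perturbed points stay in the optimal face.
  have hcl : ε * (c ⬝ᵥ ⇑l) = 0 := by linarith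
  have hseg : x ∈ openSegment ℝ (x + ε • ⇑l) (x + (-ε) • ⇑l) := by
    refine ⟨1 / 2, 1 / 2, by norm_num, by norm_num, by norm_num, ?_⟩
    funext j
    simp only [Pi.add_apply, Pi.smul_apply, smul_eq_mul]
    ring
  have hx := hext ⟨hp, by
      simp only [Set.mem_ofPred_eq, dotProduct_add, dotProduct_smul, smul_eq_mul, hxc', hcl,
        add_zero]⟩
    ⟨hn, by
      simp only [Set.mem_ofPred_eq, dotProduct_add, dotProduct_smul, smul_eq_mul, hxc', neg_mul,
        hcl, neg_zero, add_zero]⟩ hseg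
  refine hne0 (Finsupp.ext fun j => ?_)
  have hj := congrFun hx j
  simpa [hε.ne'] using hj

/-- Gordan's alternative: finitely many vectors, no nontrivial nonnegative combination of which
vanishes, lie in an open half-space. -/
theorem exists_dotProduct_pos {ι κ : Type*} [Fintype ι] [Fintype κ] (v : ι → κ → ℝ)
    (h : ∀ w : ι → ℝ, (∀ i, 0 ≤ w i) → (∀ k, ∑ i, w i * v i k = 0) → ∀ i, w i = 0) :
    ∃ y : κ → ℝ, ∀ i, 0 < ∑ k, y k * v i k := by
  classical
  let f : (ι → ℝ) →ₗ[ℝ] (κ → ℝ) := Fintype.linearCombination ℝ v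
  have hf : ∀ w k, f w k = ∑ i, w i * v i k := fun w k => by
    simp [f, Fintype.linearCombination_apply]
  have hcomp : IsCompact (f '' stdSimplex ℝ ι) :=
    (isCompact_stdSimplex ℝ ι).image f.continuous_of_finiteDimensional
  have hconv : Convex ℝ (f '' stdSimplex ℝ ι) := (convex_stdSimplex ℝ ι).linear_image f
  have h0 : (0 : κ → ℝ) ∉ f '' stdSimplex ℝ ι := by
    rintro ⟨w, ⟨hw0, hw1⟩, hw⟩
    have := h w hw0 fun k => by rw [← hf, hw]; rfl
    simp [this] at hw1
  -- The image of the simplex is compact and convex and misses `0`, so it is strictly separated from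
  -- `0`.
  obtain ⟨g, u, hu, hg⟩ := geometric_hahn_banach_point_closed hconv hcomp.isClosed h0
  refine ⟨fun k => g (Pi.single k 1), fun i => ?_⟩
  have h1 := hg _ ⟨Pi.single i 1, single_mem_stdSimplex ℝ i, rfl⟩
  have h2 : f (Pi.single i 1) = v i := by
    funext k
    simp [hf, Pi.single_apply]
  have h3 : g (v i) = ∑ k, g (Pi.single k 1) * v i k := by
    conv_lhs => rw [← Finset.univ_sum_single (v i)]
    rw [map_sum]
    refine Finset.sum_congr rfl fun k _ => ?_
    have : (Pi.single k (v i k) : κ → ℝ) = v i k • Pi.single k 1 := by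
      rw [← Pi.single_smul, smul_eq_mul, mul_one]
    rw [this, map_smul, smul_eq_mul, mul_comm]
  rw [h2, h3] at h1
  rw [map_zero] at hu
  exact hu.trans h1

/-- Approximate strong duality: a lower bound on the optimal value, strict up to `z`, is certified
by nonnegative dual slacks. -/
theorem exists_dual_slacks (hbdd : Bornology.IsBounded (feasibleSet A b))
    (hne : (feasibleSet A b).Nonempty) {z : ℝ} (hz : ∀ y ∈ feasibleSet A b, z < c ⬝ᵥ y) :
    ∃ (s : Fin n → ℝ) (u : ℝ), (∀ j, 0 ≤ s j) ∧ z ≤ u ∧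
      ∀ x ∈ feasibleSet A b, ∑ j, s j * x j = c ⬝ᵥ x - u := by
  -- The vectors are `(-z, -b)`, the slack `(1, 0)` and the columns `(c j, A_j)`. A vanishing
  -- nonnegative combination with positive weight on the first rescales to a feasible point of cost
  -- at most `z`; with weight zero there it is a recession direction, hence trivial.
  let v : Option (Option (Fin n)) → Option (Fin m) → ℝ := fun i k =>
    match i, k with
    | none, none => -z
    | none, some k => -b k
    | some none, none => 1
    | some none, some _ => 0
    | some (some j), none => c j
    | some (some j), some k => A k j
  have hv : ∀ w : Option (Option (Fin n)) → ℝ, (∀ i, 0 ≤ w i) →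
      (∀ k, ∑ i, w i * v i k = 0) → ∀ i, w i = 0 := by
    intro w hw0 hw
    have hc := hw none
    have hAw : A *ᵥ (fun j => w (some (some j))) = w none • b := by
      funext k
      have h1 := hw (some k)
      simp only [Fintype.sum_option, v] at h1
      simp only [mulVec, dotProduct, Pi.smul_apply, smul_eq_mul, mul_comm (A k _)]
      linarith
    simp only [Fintype.sum_option, v] at hc
    have hcw : c ⬝ᵥ (fun j => w (some (some j))) = ∑ j, w (some (some j)) * c j := by
      simp only [dotProduct, mul_comm]
    have hτ : w none = 0 := by
      by_contra hτ
      have hpos : 0 < w none := lt_of_le_of_ne (hw0 _) (Ne.symm hτ)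
      have hmem : (w none)⁻¹ • (fun j => w (some (some j))) ∈ feasibleSet A b := by
        refine ⟨by rw [mulVec_smul, hAw, smul_smul, inv_mul_cancel₀ hτ, one_smul], fun j => ?_⟩
        exact mul_nonneg (inv_nonneg.2 hpos.le) (hw0 _)
      have h2 := hz _ hmem
      rw [dotProduct_smul, smul_eq_mul, hcw, lt_inv_mul_iff₀ hpos] at h2
      linarith [hw0 (some none)]
    have hx : (fun j => w (some (some j))) = 0 :=
      eq_zero_of_nonneg_of_mulVec_eq_zero hbdd hne (fun j => hw0 _) (by rw [hAw, hτ, zero_smul])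
    have hx' : ∀ j, w (some (some j)) = 0 := fun j => congrFun hx j
    rintro (_ | _ | j)
    · exact hτ
    · simpa [hτ, hx'] using hc
    · exact hx' j
  obtain ⟨y, hy⟩ := exists_dotProduct_pos v hv
  have h1 := hy none
  have h2 := hy (some none)
  simp only [Fintype.sum_option, v, mul_one, mul_zero, Finset.sum_const_zero, add_zero] at h1 h2
  -- The slack vector makes `y none` positive; dividing by it turns the other coordinates of `y`,
  -- negated, into dual multipliers.
  refine ⟨fun j => (y none * c j + ∑ k, y (some k) * A k j) / y none,
    -((∑ k, y (some k) * b k) / y none), fun j => ?_, ?_, fun x hx => ?_⟩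
  · have h3 := hy (some (some j))
    simp only [Fintype.sum_option, v] at h3
    positivity
  · rw [← neg_div, le_div_iff₀ h2]
    simp only [mul_neg, Finset.sum_neg_distrib] at h1
    linarith
  · have h4 : ∑ j, (∑ k, y (some k) * A k j) * x j = ∑ k, y (some k) * b k := by
      simp only [← hx.1, mulVec, dotProduct, Finset.sum_mul, Finset.mul_sum]
      rw [Finset.sum_comm]
      simp only [mul_assoc]
    rw [← h4, sub_neg_eq_add, dotProduct, Finset.sum_div, ← Finset.sum_add_distrib]
    refine Finset.sum_congr rfl fun j _ => ?_
    field_simp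

end Optimum

end SteepestEdge

namespace SteepestEdge

/-! ### Progress of a pivot and forced coordinates -/

section Pivot

variable {m n : ℕ} {A : Matrix (Fin m) (Fin n) ℝ} {b : Fin m → ℝ} {c : Fin n → ℝ}
  {β : Fin m → Fin n}

theorem IsLeaving.pivot {q : Fin n} {p : Fin m} (hβ : IsFeasibleBasis A b β)
    (hq : q ∉ Set.range β) (hp : IsLeaving A b β q p) :
    IsFeasibleBasis A b (Function.update β p q) ∧
      basicSolution A b (Function.update β p q) = basicSolution A b β +
        (((basisMatrix A β)⁻¹ *ᵥ b) p / tableauColumn A β q p) • edgeDirection A β q := by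
  obtain ⟨htab, hratio⟩ := hp
  set θ := ((basisMatrix A β)⁻¹ *ᵥ b) p / tableauColumn A β q p with hθ
  have hθ0 : 0 ≤ θ := div_nonneg (hβ.2 p) htab.le
  have hdet : (basisMatrix A (Function.update β p q)).det ≠ 0 := by
    rw [det_update_basisMatrix hβ.1]
    exact mul_ne_zero htab.ne' hβ.1
  have hcoord : ∀ i, (basicSolution A b β + θ • edgeDirection A β q) (β i) =
      ((basisMatrix A β)⁻¹ *ᵥ b) i - θ * tableauColumn A β q i := fun i => by
    rw [Pi.add_apply, Pi.smul_apply, basicSolution_apply hβ.1, edgeDirection_apply_basic hβ.1 hq,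
      smul_eq_mul]
    ring
  have hcoord' : ∀ j, j ∉ Set.range β → (basicSolution A b β + θ • edgeDirection A β q) j =
      θ * (Pi.single q 1 : Fin n → ℝ) j := fun j hj => by
    rw [Pi.add_apply, Pi.smul_apply, basicSolution_apply_of_notMem hj,
      edgeDirection_apply_of_notMem q hj, smul_eq_mul, zero_add]
  have hmem : basicSolution A b β + θ • edgeDirection A β q ∈ feasibleSet A b := by
    refine ⟨?_, fun j => ?_⟩
    · rw [mulVec_add, mulVec_smul, mulVec_edgeDirection hβ.1, mulVec_basicSolution hβ.1, smul_zero,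
        add_zero]
    · by_cases hj : j ∈ Set.range β
      · obtain ⟨i, rfl⟩ := hj
        rw [hcoord, sub_nonneg]
        rcases le_or_gt (tableauColumn A β q i) 0 with hi | hi
        · exact (mul_nonpos_of_nonneg_of_nonpos hθ0 hi).trans (hβ.2 i)
        · exact (le_div_iff₀ hi).1 (hratio i hi)
      · rw [hcoord' j hj, Pi.single_apply]
        split_ifs <;> simp [hθ0]
  have hsupp : ∀ j, j ∉ Set.range (Function.update β p q) →
      (basicSolution A b β + θ • edgeDirection A β q) j = 0 := by
    intro j hj
    have hjq : j ≠ q := fun h => hj ⟨p, by simp [h]⟩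
    by_cases hjr : j ∈ Set.range β
    · obtain ⟨i, rfl⟩ := hjr
      have hip : i = p := by
        by_contra hip
        exact hj ⟨i, by simp [hip]⟩
      rw [hcoord, hip, hθ, div_mul_cancel₀ _ htab.ne', sub_self]
    · simp [hcoord' j hjr, hjq]
  exact ⟨isFeasibleBasis_of_supported hdet hsupp hmem, (eq_basicSolution hdet hsupp hmem.1).symm⟩

theorem IsSteepestEdgePivot.isFeasibleBasis {β' : Fin m → Fin n} (hβ : IsFeasibleBasis A b β)
    (hpiv : IsSteepestEdgePivot A b c β β') : IsFeasibleBasis A b β' := by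
  obtain ⟨q, p, hq, hp, rfl⟩ := hpiv
  exact (hp.pivot hβ hq.1).1

/-- The steepest-edge rule bounds the optimality gap by the slope of the entering edge. -/
theorem IsSteepestEdgeEntering.gap_le {γ Δ lam : ℝ}
    (hγ : IsGreatest (positiveCoordinates A b) γ) (hΔ : IsGreatest (absSubdeterminants A) Δ)
    (hlam : IsLeast (absSubdeterminants A) lam) (hm : 1 ≤ m) (hβ : IsFeasibleBasis A b β)
    {q : Fin n} (hq : IsSteepestEdgeEntering A c β q) {y : Fin n → ℝ} (hy : IsBFS A b y) :
    c ⬝ᵥ basicSolution A b β - c ⬝ᵥ y ≤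
      -normalizedReducedCost A c β q * (√(2 * (m : ℝ)) * (Δ / lam) * (m * γ)) := by
  classical
  obtain ⟨hqβ, hneg, hmin⟩ := hq
  have hyf := hy.mem_feasibleSet
  set κ := normalizedReducedCost A c β q with hκ
  set S := √(2 * (m : ℝ)) * (Δ / lam) with hS
  have hκ0 : κ ≤ 0 := div_nonpos_of_nonpos_of_nonneg hneg.le (norm_nonneg _)
  have hS0 : 0 ≤ S :=
    (norm_nonneg _).trans (norm_edgeDirection_le hΔ hlam hm hβ.1 hqβ)
  -- Since `κ ≤ 0`, the upper bound `S` on the norms turns the steepest-edge inequality into a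
  -- uniform lower bound on reduced costs.
  have hrc : ∀ q', q' ∉ Set.range β → κ * S ≤ reducedCost A c β q' := by
    intro q' hq'
    have h1 := one_le_norm_edgeDirection hβ.1 hq'
    have h2 := hmin q' hq'
    rw [normalizedReducedCost, le_div_iff₀ (by linarith)] at h2
    exact (mul_le_mul_of_nonpos_left (norm_edgeDirection_le hΔ hlam hm hβ.1 hq') hκ0).trans h2
  have h1 := dotProduct_sub_eq_sum (c := c) hβ.1 hyf.1
  have h2 : ∑ q' with q' ∉ Set.range β, y q' * (κ * S) ≤
      ∑ q' with q' ∉ Set.range β, y q' * reducedCost A c β q' :=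
    Finset.sum_le_sum fun q' hq' =>
      mul_le_mul_of_nonneg_left (hrc q' (by simpa using hq')) (hyf.2 q')
  have h3 : ∑ q' with q' ∉ Set.range β, y q' ≤ m * γ :=
    (Finset.sum_le_univ_sum_of_nonneg hyf.2).trans (hy.sum_le hγ)
  rw [← Finset.sum_mul] at h2
  have h4 := mul_le_mul_of_nonpos_right h3 (mul_nonpos_of_nonpos_of_nonneg hκ0 hS0)
  linarith

/-- A nondegenerate steepest-edge pivot lowers the cost, by a fixed fraction of the gap. -/
theorem IsSteepestEdgePivot.gap_le {γ δ Δ lam : ℝ}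
    (hγ : IsGreatest (positiveCoordinates A b) γ) (hδ : IsLeast (positiveCoordinates A b) δ)
    (hΔ : IsGreatest (absSubdeterminants A) Δ)
    (hlam : IsLeast (absSubdeterminants A) lam) (hm : 1 ≤ m) (hβ : IsFeasibleBasis A b β)
    {β' : Fin m → Fin n} (hpiv : IsSteepestEdgePivot A b c β β')
    (hne : basicSolution A b β' ≠ basicSolution A b β) {y : Fin n → ℝ} (hy : IsBFS A b y) :
    c ⬝ᵥ basicSolution A b β' < c ⬝ᵥ basicSolution A b β ∧
      c ⬝ᵥ basicSolution A b β - c ⬝ᵥ y ≤ √(2 * (m : ℝ)) * (Δ / lam) * (m * γ) / δ *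
        (c ⬝ᵥ basicSolution A b β - c ⬝ᵥ basicSolution A b β') := by
  obtain ⟨q, p, hq, hp, rfl⟩ := hpiv
  have hgap := hq.gap_le hγ hΔ hlam hm hβ hy
  obtain ⟨hfeas, hx'⟩ := hp.pivot hβ hq.1
  set θ := ((basisMatrix A β)⁻¹ *ᵥ b) p / tableauColumn A β q p with hθ
  have hδ0 : 0 < δ := hδ.1.1
  have hθne : θ ≠ 0 := fun h => hne (by rw [hx', h, zero_smul, add_zero])
  have hθ0 : 0 < θ := lt_of_le_of_ne (div_nonneg (hβ.2 p) hp.1.le) (Ne.symm hθne)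
  -- The step length is the new value of the entering coordinate, a positive coordinate of a BFS.
  have hδθ : δ ≤ θ := by
    refine hδ.2 ⟨hθ0, _, hfeas.isBFS, q, ?_⟩
    rw [hx', Pi.add_apply, Pi.smul_apply, basicSolution_apply_of_notMem hq.1,
      edgeDirection_apply_of_notMem q hq.1]
    simp
  have hcost : c ⬝ᵥ basicSolution A b β - c ⬝ᵥ basicSolution A b (Function.update β p q) =
      θ * -reducedCost A c β q := by
    rw [hx', dotProduct_add, dotProduct_smul, reducedCost, smul_eq_mul]
    ring
  have h1 := one_le_norm_edgeDirection hβ.1 hq.1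
  have hpos := mul_pos hθ0 (neg_pos.2 hq.2.1)
  refine ⟨by linarith, ?_⟩
  have hκ : -normalizedReducedCost A c β q ≤ -reducedCost A c β q := by
    rw [normalizedReducedCost, ← neg_div]
    exact div_le_self (neg_pos.2 hq.2.1).le h1
  have h2 : δ * -normalizedReducedCost A c β q ≤ θ * -reducedCost A c β q :=
    (mul_le_mul_of_nonneg_left hκ hδ0.le).trans
      (mul_le_mul_of_nonneg_right hδθ (neg_pos.2 hq.2.1).le)
  have hS : 0 ≤ √(2 * (m : ℝ)) * (Δ / lam) * (m * γ) :=
    mul_nonneg ((norm_nonneg _).trans (norm_edgeDirection_le hΔ hlam hm hβ.1 hq.1))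
      (mul_nonneg (Nat.cast_nonneg _) hγ.1.1.le)
  rw [hcost, div_mul_eq_mul_div, le_div_iff₀ hδ0]
  have h3 := mul_le_mul_of_nonneg_right h2 hS
  have h4 := mul_le_mul_of_nonneg_right hgap hδ0.le
  linarith

/-- A nonoptimal basic feasible solution has a positive coordinate that stays below `δ` on all
feasible points whose gap is sufficiently smaller. -/
theorem IsBFS.exists_forced_coordinate {γ δ ρ : ℝ}
    (hγ : IsGreatest (positiveCoordinates A b) γ)
    (hbdd : Bornology.IsBounded (feasibleSet A b)) (hm : 1 ≤ m)
    {w : Fin n → ℝ} (hw : w ∈ feasibleSet A b) (hmin : ∀ y ∈ feasibleSet A b, c ⬝ᵥ w ≤ c ⬝ᵥ y)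
    (hρ0 : 0 ≤ ρ) (hρ : m * γ * ρ < δ)
    {y : Fin n → ℝ} (hy : IsBFS A b y) (hgap : c ⬝ᵥ w < c ⬝ᵥ y) :
    ∃ j, 0 < y j ∧ ∀ x ∈ feasibleSet A b, c ⬝ᵥ x - c ⬝ᵥ w ≤ ρ * (c ⬝ᵥ y - c ⬝ᵥ w) → x j < δ := by
  have hm' : (0 : ℝ) < m := by exact_mod_cast hm
  have hγ0 : 0 < γ := hγ.1.1
  have hyγ := hy.le_of_isGreatest hγ
  have hyf := hy.mem_feasibleSet
  -- The strict inequality `hρ` leaves room for the error `η * G` of approximate duality; this `η`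
  -- puts `m * γ * (ρ + η)` halfway between `m * γ * ρ` and `δ`.
  obtain ⟨η, hη, hηδ⟩ : ∃ η > 0, m * γ * (ρ + η) < δ := by
    refine ⟨(δ - m * γ * ρ) / (2 * (m * γ)), by have := sub_pos.2 hρ; positivity, ?_⟩
    have : m * γ * (ρ + (δ - m * γ * ρ) / (2 * (m * γ))) = (δ + m * γ * ρ) / 2 := by
      field_simp
      ring
    linarith
  set G := c ⬝ᵥ y - c ⬝ᵥ w with hG
  have hG0 : 0 < G := sub_pos.2 hgap
  obtain ⟨s, u, hs, hu, hsx⟩ := exists_dual_slacks (c := c) hbdd ⟨y, hyf⟩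
    (z := c ⬝ᵥ w - η * G) fun x hx => by linarith [hmin x hx, mul_pos hη hG0]
  have huz : ∑ j, s j * y j = c ⬝ᵥ y - u := hsx y hyf
  obtain ⟨β, hβ, rfl⟩ := hy
  have huz' : u ≤ c ⬝ᵥ w := by
    have h1 := hsx w hw
    have h2 : 0 ≤ ∑ j, s j * w j := Finset.sum_nonneg fun j _ => mul_nonneg (hs j) (hw.2 j)
    linarith
  have hsum : G ≤ ∑ i, s (β i) * ((basisMatrix A β)⁻¹ *ᵥ b) i := by
    rw [← sum_mul_extendByZero]
    change G ≤ ∑ j, s j * basicSolution A b β j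
    linarith
  -- Some basic index carries at least the average share of the gap; as its coordinate is at most
  -- `γ`, its slack is at least `G / (m * γ)`.
  obtain ⟨i, -, hi⟩ : ∃ i ∈ Finset.univ,
      G / m ≤ s (β i) * ((basisMatrix A β)⁻¹ *ᵥ b) i := by
    have : Nonempty (Fin m) := ⟨⟨0, hm⟩⟩
    refine Finset.exists_le_of_sum_le Finset.univ_nonempty ?_
    rw [Finset.sum_const, Finset.card_univ, Fintype.card_fin, nsmul_eq_mul,
      mul_div_cancel₀ _ hm'.ne']
    exact hsum
  rw [← basicSolution_apply (b := b) hβ.1] at hi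
  have hpos : 0 < s (β i) * basicSolution A b β (β i) := (div_pos hG0 hm').trans_le hi
  have hspos : 0 < s (β i) := pos_of_mul_pos_left hpos (hyf.2 _)
  refine ⟨β i, pos_of_mul_pos_right hpos hspos.le, fun x hx hxgap => ?_⟩
  have h1 : s (β i) * x (β i) ≤ ∑ j, s j * x j :=
    Finset.single_le_sum (f := fun j => s j * x j) (fun j _ => mul_nonneg (hs j) (hx.2 j))
      (Finset.mem_univ _)
  rw [hsx x hx] at h1
  have h2 : G ≤ m * (s (β i) * γ) := by
    rw [div_le_iff₀' hm'] at hi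
    exact hi.trans (mul_le_mul_of_nonneg_left
      (mul_le_mul_of_nonneg_left (hyγ _) hspos.le) hm'.le)
  have h3 : s (β i) * x (β i) ≤ s (β i) * (m * γ * (ρ + η)) := by
    have h4 := mul_le_mul_of_nonneg_left h2 (add_nonneg hρ0 hη.le)
    linarith
  exact (le_of_mul_le_mul_left h3 hspos).trans_lt hηδ

end Pivot

end SteepestEdge

namespace SteepestEdge

/-! ### Counting changes along a sequence -/

section Counting

open Classical in
/-- Among the first `t + 1` terms of a sequence there are at most one more distinct values than
there are changes. -/
theorem encard_image_Iic_le {α : Type*} (x : ℕ → α) (t : ℕ) :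
    (x '' Set.Iic t).encard ≤ (Nat.count (fun s => x (s + 1) ≠ x s) t + 1 : ℕ) := by
  induction t with
  | zero =>
    have : Set.Iic 0 = ({0} : Set ℕ) := by ext; simp
    simp [this]
  | succ t ih =>
    have hI : Set.Iic (t + 1) = insert (t + 1) (Set.Iic t) := by
      ext s
      simp only [Set.mem_Iic, Set.mem_insert_iff]
      omega
    rw [hI, Set.image_insert_eq, Nat.count_succ]
    split_ifs with h
    · refine (Set.encard_insert_le _ _).trans ((add_le_add_left ih 1).trans (le_of_eq ?_))
      norm_cast
    · rw [Set.insert_eq_of_mem]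
      · exact ih
      · exact ⟨t, Set.mem_Iic.2 le_rfl, (not_not.1 h).symm⟩

open Classical in
/-- A sequence with more than `L` distinct values up to the time `T` changes at least `L` times
before some time `t ≤ T`. -/
theorem exists_le_count_of_lt_encard {α : Type*} (x : ℕ → α) (T : ℕ∞) (L : ℕ)
    (h : (L : ℕ∞) < {y | ∃ t : ℕ, (t : ℕ∞) ≤ T ∧ y = x t}.encard) :
    ∃ t : ℕ, (t : ℕ∞) ≤ T ∧ L ≤ Nat.count (fun s => x (s + 1) ≠ x s) t := by
  obtain ⟨S, hS, hcard⟩ := Set.exists_subset_encard_eq (Order.add_one_le_of_lt h)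
  have hfin : S.Finite := Set.finite_of_encard_eq_coe (k := L + 1) (by rw [hcard]; norm_cast)
  have hne : S.Nonempty := by
    rw [← Set.encard_pos, hcard]
    positivity
  choose! f hfT hf using fun y (hy : y ∈ S) => hS hy
  -- Only `L + 1` values are retained, so a latest witnessing time exists even when `T = ⊤`.
  obtain ⟨y, hy, hmax⟩ := hfin.exists_maximalFor f S hne
  refine ⟨f y, hfT y hy, ?_⟩
  have hsub : S ⊆ x '' Set.Iic (f y) := fun w hw =>
    ⟨f w, (le_total (f w) (f y)).elim id fun h => hmax hw h, (hf w hw).symm⟩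
  have h1 := (Set.encard_le_encard hsub).trans (encard_image_Iic_le x (f y))
  rw [hcard] at h1
  have h2 : L + 1 ≤ Nat.count (fun s => x (s + 1) ≠ x s) (f y) + 1 := by exact_mod_cast h1
  omega

theorem exists_count_eq (p : ℕ → Prop) [DecidablePred p] {t i : ℕ} (hi : i ≤ Nat.count p t) :
    ∃ s ≤ t, Nat.count p s = i := by
  induction t with
  | zero => exact ⟨0, le_rfl, by simp at hi ⊢; omega⟩
  | succ t ih =>
    by_cases h : i ≤ Nat.count p t
    · obtain ⟨s, hs, hsi⟩ := ih h
      exact ⟨s, by omega, hsi⟩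
    · refine ⟨t + 1, le_rfl, ?_⟩
      rw [Nat.count_succ] at hi ⊢
      split_ifs at hi ⊢ <;> omega

/-- Geometric decay along the steps that satisfy `p`. -/
theorem le_pow_count_sub_mul (p : ℕ → Prop) [DecidablePred p] {g : ℕ → ℝ} {r : ℝ} (hr : 0 ≤ r)
    {N : ℕ} (hp : ∀ s < N, p s → g (s + 1) ≤ r * g s) (hnp : ∀ s < N, ¬ p s → g (s + 1) = g s)
    {s t : ℕ} (hst : s ≤ t) (htN : t ≤ N) :
    g t ≤ r ^ (Nat.count p t - Nat.count p s) * g s := by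
  induction t, hst using Nat.le_induction with
  | base => simp
  | succ t hst ih =>
    have ih := ih (by omega)
    have hmono := Nat.count_monotone p hst
    rw [Nat.count_succ]
    split_ifs with h
    · rw [show Nat.count p t + 1 - Nat.count p s = (Nat.count p t - Nat.count p s) + 1 by omega,
        pow_succ', mul_assoc]
      exact (hp t (by omega) h).trans (mul_le_mul_of_nonneg_left ih hr)
    · rw [hnp t (by omega) h]
      exact ih

theorem lt_of_count_lt (p : ℕ → Prop) [DecidablePred p] {g : ℕ → ℝ}
    {N : ℕ} (hp : ∀ s < N, p s → g (s + 1) < g s) (hnp : ∀ s < N, ¬ p s → g (s + 1) = g s)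
    {s t : ℕ} (htN : t ≤ N) (h : Nat.count p s < Nat.count p t) : g t < g s := by
  have hst : s < t := lt_of_not_ge fun hts => (Nat.count_monotone p hts).not_gt h
  have hanti : ∀ k, s ≤ k → k ≤ N →
      g k ≤ g s ∧ (Nat.count p s < Nat.count p k → g k < g s) := by
    intro k hsk
    induction k, hsk using Nat.le_induction with
    | base => simp
    | succ k hsk ih =>
      intro hk
      obtain ⟨h1, h2⟩ := ih (by omega)
      by_cases hpk : p k
      · have := (hp k (by omega) hpk).trans_le h1
        exact ⟨this.le, fun _ => this⟩
      · rw [hnp k (by omega) hpk, Nat.count_succ, if_neg hpk]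
        exact ⟨h1, h2⟩
  exact (hanti t hst.le htN).2 h

/-- Since `1 - 1/M < exp (-1/M)`, the power is less than `exp (-K/M)`; `1 ≤ K` keeps the inequality
strict. -/
theorem one_sub_inv_pow_lt {M R : ℝ} (hM : 1 ≤ M) (hR : 0 < R) {K : ℕ} (hK : 1 ≤ K)
    (hKM : M * Real.log R ≤ K) : (1 - M⁻¹) ^ K < R⁻¹ := by
  have hM0 : 0 < M := by linarith
  have h1 : 1 - M⁻¹ < Real.exp (-M⁻¹) := by
    have := Real.add_one_lt_exp (neg_ne_zero.2 (inv_ne_zero hM0.ne'))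
    linarith
  have h2 : 0 ≤ 1 - M⁻¹ := sub_nonneg.2 (inv_le_one_of_one_le₀ hM)
  calc (1 - M⁻¹) ^ K < Real.exp (-M⁻¹) ^ K := pow_lt_pow_left₀ h1 h2 (by omega)
    _ = Real.exp (-(K / M)) := by
      rw [← Real.exp_nat_mul]
      congr 1
      field_simp
    _ ≤ Real.exp (-Real.log R) := by
      rw [Real.exp_le_exp, neg_le_neg_iff, le_div_iff₀' hM0]
      exact hKM
    _ = R⁻¹ := by rw [Real.exp_neg, Real.exp_log hR]

end Counting

/-! ### Bounding a run -/

section Run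

variable {m n : ℕ} {A : Matrix (Fin m) (Fin n) ℝ} {b : Fin m → ℝ} {c : Fin n → ℝ}

theorem IsSteepestEdgeRun.isFeasibleBasis {T : ℕ∞} {β : ℕ → Fin m → Fin n}
    (hrun : IsSteepestEdgeRun A b c T β) (t : ℕ) (ht : (t : ℕ∞) ≤ T) :
    IsFeasibleBasis A b (β t) := by
  induction t with
  | zero => exact hrun.1
  | succ t ih =>
    have ht' : (t : ℕ∞) < T := lt_of_lt_of_le (by exact_mod_cast t.lt_succ_self) ht
    exact (hrun.2 t ht').isFeasibleBasis (ih ht'.le)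

theorem exists_ne_zero_of_isBFS {γ : ℝ} (hγ : γ ∈ positiveCoordinates A b) {x : Fin n → ℝ}
    (hx : x ∈ feasibleSet A b) : ∃ j, x j ≠ 0 := by
  by_contra! h0
  obtain ⟨hγ0, y, ⟨β, hβ, rfl⟩, j, hj⟩ := hγ
  have hb : b = 0 := by
    rw [← hx.1, show x = 0 from funext h0, mulVec_zero]
  have : basicSolution A b β = 0 :=
    eq_zero_of_mulVec_eq_zero hβ.1 (fun j hj => basicSolution_apply_of_notMem hj)
      (by rw [mulVec_basicSolution hβ.1, hb])
  rw [this] at hj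
  exact hγ0.ne hj

/-- A geometric rate of decrease of the gap over the changes of the basic feasible solution bounds
the number of basic feasible solutions that a run generates. -/
theorem IsSteepestEdgeRun.encard_generatedBFS_le {γ δ M : ℝ}
    (hA : A.rank = m) (hbdd : Bornology.IsBounded (feasibleSet A b))
    (hγ : IsGreatest (positiveCoordinates A b) γ) (hδ : IsLeast (positiveCoordinates A b) δ)
    (hm : 1 ≤ m) (hM : 1 ≤ M)
    (hgap : ∀ β β' : Fin m → Fin n, IsFeasibleBasis A b β → IsSteepestEdgePivot A b c β β' →
      basicSolution A b β' ≠ basicSolution A b β → ∀ y, IsBFS A b y →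
      c ⬝ᵥ basicSolution A b β' < c ⬝ᵥ basicSolution A b β ∧
        c ⬝ᵥ basicSolution A b β - c ⬝ᵥ y ≤
          M * (c ⬝ᵥ basicSolution A b β - c ⬝ᵥ basicSolution A b β'))
    {K : ℕ} (hK : 1 ≤ K) (hKM : M * Real.log (m * γ / δ) ≤ K)
    {T : ℕ∞} {β : ℕ → Fin m → Fin n} (hrun : IsSteepestEdgeRun A b c T β) :
    (generatedBFS A b T β).encard ≤ (n * K : ℕ) := by
  classical
  have hm' : (0 : ℝ) < m := by exact_mod_cast hm
  have hγ0 : 0 < γ := hγ.1.1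
  have hδ0 : 0 < δ := hδ.1.1
  have hM0 : 0 < M := by linarith
  by_contra! hlt
  set x : ℕ → Fin n → ℝ := fun t => basicSolution A b (β t) with hx
  obtain ⟨N, hNT, hN⟩ := exists_le_count_of_lt_encard x T (n * K) hlt
  set p : ℕ → Prop := fun s => x (s + 1) ≠ x s with hp
  replace hN : n * K ≤ Nat.count p N := by convert hN
  obtain ⟨w, hw, hmin⟩ := exists_isBFS_isMinOn (c := c) hA hbdd ⟨_, hrun.1.basicSolution_mem⟩
  have hBFS : ∀ t ≤ N, IsBFS A b (x t) := fun t ht =>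
    (hrun.isFeasibleBasis t (le_trans (by exact_mod_cast ht) hNT)).isBFS
  have hstep : ∀ s < N, p s → c ⬝ᵥ x (s + 1) < c ⬝ᵥ x s ∧
      c ⬝ᵥ x s - c ⬝ᵥ w ≤ M * (c ⬝ᵥ x s - c ⬝ᵥ x (s + 1)) := by
    intro s hs hps
    have hsT : (s : ℕ∞) < T := lt_of_lt_of_le (by exact_mod_cast hs) hNT
    exact hgap _ _ (hrun.isFeasibleBasis s hsT.le) (hrun.2 s hsT) hps w hw
  set r := 1 - M⁻¹ with hr
  have hr0 : 0 ≤ r := sub_nonneg.2 (inv_le_one_of_one_le₀ hM)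
  have hdecay : ∀ s < N, p s → c ⬝ᵥ x (s + 1) - c ⬝ᵥ w ≤ r * (c ⬝ᵥ x s - c ⬝ᵥ w) := by
    intro s hs hps
    have h1 := (inv_mul_le_iff₀ hM0).2 (hstep s hs hps).2
    rw [hr, sub_mul, one_mul]
    linarith
  have hstay : ∀ s < N, ¬ p s → c ⬝ᵥ x (s + 1) - c ⬝ᵥ w = c ⬝ᵥ x s - c ⬝ᵥ w := by
    intro s _ hps
    rw [not_not.1 hps]
  have hρ : m * γ * r ^ K < δ := by
    have h1 := one_sub_inv_pow_lt hM (by positivity : 0 < m * γ / δ) hK hKM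
    rw [inv_div, lt_div_iff₀ (by positivity)] at h1
    linarith
  -- The time `τ l` completes `l` blocks of `K` changes each.
  have hτ : ∀ l : ℕ, l ≤ n → ∃ t ≤ N, Nat.count p t = l * K := fun l hl =>
    exists_count_eq p ((Nat.mul_le_mul_right K hl).trans hN)
  choose! τ hτN hτc using hτ
  have hforced : ∀ l : Fin n, ∃ j, 0 < x (τ l) j ∧ ∀ y ∈ feasibleSet A b,
      c ⬝ᵥ y - c ⬝ᵥ w ≤ r ^ K * (c ⬝ᵥ x (τ l) - c ⬝ᵥ w) → y j < δ := by
    intro l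
    -- A further change, with its strict drop in cost, occurs before `τ n`, so the BFS at `τ l` is
    -- not optimal.
    have hlt' : Nat.count p (τ l) < Nat.count p (τ n) := by
      rw [hτc _ l.2.le, hτc n le_rfl]
      exact Nat.mul_lt_mul_of_pos_right l.2 hK
    have h1 := lt_of_count_lt p (g := fun s => c ⬝ᵥ x s - c ⬝ᵥ w)
      (fun s hs hps => sub_lt_sub_right (hstep s hs hps).1 _) hstay (hτN n le_rfl) hlt'
    have h2 := hmin _ (hBFS _ (hτN n le_rfl)).mem_feasibleSet
    exact (hBFS _ (hτN _ l.2.le)).exists_forced_coordinate hγ hbdd hm hw.mem_feasibleSet hmin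
      (pow_nonneg hr0 K) hρ (by linarith)
  choose j hjpos hj using hforced
  have hzero : ∀ (l : Fin n) (l' : ℕ), (l : ℕ) < l' → l' ≤ n → x (τ l') (j l) = 0 := by
    intro l l' hll' hl'
    have hB := hBFS _ (hτN l' hl')
    refine hB.eq_zero_of_lt hδ (hj l _ hB.mem_feasibleSet ?_)
    have hc : Nat.count p (τ l) + K ≤ Nat.count p (τ l') := by
      rw [hτc _ l.2.le, hτc l' hl', ← Nat.succ_mul]
      exact Nat.mul_le_mul_right K hll'
    have hle : τ l ≤ τ l' := le_of_not_gt fun h => by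
      have := Nat.count_monotone p h.le
      omega
    have h1 := le_pow_count_sub_mul p (g := fun s => c ⬝ᵥ x s - c ⬝ᵥ w) hr0 hdecay hstay hle
      (hτN l' hl')
    have h2 : 0 ≤ c ⬝ᵥ x (τ l) - c ⬝ᵥ w :=
      sub_nonneg.2 (hmin _ (hBFS _ (hτN _ l.2.le)).mem_feasibleSet)
    refine h1.trans (mul_le_mul_of_nonneg_right (pow_le_pow_of_le_one hr0 ?_ (by omega)) h2)
    exact sub_le_self _ (inv_nonneg.2 hM0.le)
  -- The coordinate chosen at `τ l'` is positive there, while all those chosen earlier already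
  -- vanish.
  have hinj : Function.Injective j := by
    have key : ∀ l l' : Fin n, l < l' → j l ≠ j l' := fun l l' hll' h =>
      (hjpos l').ne' (h ▸ hzero l l' hll' l'.2.le)
    intro l l' h
    rcases lt_trichotomy l l' with h1 | h1 | h1
    · exact absurd h (key _ _ h1)
    · exact h1
    · exact absurd h.symm (key _ _ h1)
  obtain ⟨k, hk⟩ := exists_ne_zero_of_isBFS hγ.1 (hBFS _ (hτN n le_rfl)).mem_feasibleSet
  obtain ⟨l, rfl⟩ := Finite.surjective_of_injective hinj k
  exact hk (hzero l n l.2 le_rfl)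

end Run

end SteepestEdge

theorem mainTheorem12 {m n : ℕ} (hmn : m < n)
    (A : Matrix (Fin m) (Fin n) ℝ) (hA : A.rank = m)
    (b : Fin m → ℝ) (c : Fin n → ℝ)
    (hbdd : Bornology.IsBounded (SteepestEdge.feasibleSet A b))
    (γ δ Δ lam : ℝ)
    (hγ : IsGreatest (SteepestEdge.positiveCoordinates A b) γ)
    (hδ : IsLeast (SteepestEdge.positiveCoordinates A b) δ)
    (hΔ : IsGreatest (SteepestEdge.absSubdeterminants A) Δ)
    (hlam : IsLeast (SteepestEdge.absSubdeterminants A) lam)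
    (hne : ¬ (m = 1 ∧ γ = δ))
    (T : ℕ∞) (β : ℕ → Fin m → Fin n) (hrun : SteepestEdge.IsSteepestEdgeRun A b c T β) :
    (SteepestEdge.generatedBFS A b T β).encard ≤
      ((n * ⌈(m : ℝ) * √(2 * (m : ℝ)) * (γ ^ 2 * Δ / (δ ^ 2 * lam)) *
        Real.log ((m : ℝ) * γ / δ)⌉₊ : ℕ) : ℕ∞) := by
  have hδ0 : 0 < δ := hδ.1.1
  have hδγ : δ ≤ γ := hδ.2 hγ.1
  have hl : 0 < lam := by
    obtain ⟨h0, f, hf⟩ := hlam.1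
    exact lt_of_le_of_ne (hf ▸ abs_nonneg _) (Ne.symm h0)
  have hlΔ : 1 ≤ Δ / lam := (one_le_div hl).2 (hlam.2 hΔ.1)
  have hρ : 1 ≤ γ / δ := (one_le_div hδ0).2 hδγ
  have hm : 1 ≤ m := by
    rcases Nat.eq_zero_or_pos m with rfl | h
    · obtain ⟨h0, x, ⟨β', -, rfl⟩, j, hj⟩ := hγ.1
      rw [SteepestEdge.basicSolution_apply_of_notMem (by rintro ⟨i, -⟩; exact i.elim0)] at hj
      exact absurd hj h0.ne
    · exact h
  have hm' : (1 : ℝ) ≤ m := by exact_mod_cast hm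
  have hsqrt : 1 ≤ √(2 * (m : ℝ)) := Real.one_le_sqrt.2 (by linarith)
  -- Excluding `m = 1`, `γ = δ` makes the logarithm positive, hence `K ≥ 1`.
  have hlog : 0 < Real.log (m * γ / δ) := by
    refine Real.log_pos ((one_lt_div hδ0).2 ?_)
    rcases hm.lt_or_eq with h | h
    · have : (1 : ℝ) < m := by exact_mod_cast h
      nlinarith
    · have : δ < γ := lt_of_le_of_ne hδγ fun h' => hne ⟨h.symm, h'.symm⟩
      nlinarith
  have hmsqrt : 1 ≤ (m : ℝ) * √(2 * (m : ℝ)) := one_le_mul_of_one_le_of_one_le hm' hsqrt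
  have hMeq : (m : ℝ) * √(2 * (m : ℝ)) * (γ ^ 2 * Δ / (δ ^ 2 * lam)) =
      (m : ℝ) * √(2 * (m : ℝ)) * ((γ / δ) ^ 2 * (Δ / lam)) := by
    field_simp
  have hM : 1 ≤ (m : ℝ) * √(2 * (m : ℝ)) * (γ ^ 2 * Δ / (δ ^ 2 * lam)) := by
    rw [hMeq]
    exact one_le_mul_of_one_le_of_one_le hmsqrt
      (one_le_mul_of_one_le_of_one_le (one_le_pow₀ hρ) hlΔ)
  refine hrun.encard_generatedBFS_le hA hbdd hγ hδ hm hM (fun β₁ β₂ hβ₁ hpiv hne' y hy => ?_)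
    (Nat.one_le_ceil_iff.2 (mul_pos (by linarith) hlog)) (Nat.le_ceil _)
  obtain ⟨hdec, hle⟩ := hpiv.gap_le hγ hδ hΔ hlam hm hβ₁ hne' hy
  refine ⟨hdec, hle.trans (mul_le_mul_of_nonneg_right ?_ (sub_nonneg.2 hdec.le))⟩
  -- The contraction argument needs only the first power of `γ / δ`; the square in the stated bound
  -- is a weakening, as `γ / δ ≥ 1`.
  calc √(2 * (m : ℝ)) * (Δ / lam) * (m * γ) / δ
      = (m : ℝ) * √(2 * (m : ℝ)) * (γ / δ * (Δ / lam)) := by ring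
    _ ≤ (m : ℝ) * √(2 * (m : ℝ)) * ((γ / δ) ^ 2 * (Δ / lam)) := by
      have h1 : γ / δ ≤ (γ / δ) ^ 2 := le_self_pow₀ hρ two_ne_zero
      gcongr
    _ = _ := hMeq.symm
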